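/- Consider regression on $[0,1]$ (so $d=1$): for $f^\circ:[0,1]\to\mathbb R$ one observes $Y_i=f^\circ(X_i)+\xi_i$, $i=1,\dots,n$, where all $X_i,\xi_i$ are independent, the $X_i$ are uniformly distributed on $[0,1]$ and $\xi_i\sim N(0,\sigma^2)$, $\sigma>0$. The $L^2$ risk of an estimator $\hat f$ (a measurable function of the data) is $R(\hat f,f^\circ)=\mathrm E\big[\|\hat f-f^\circ\|_{L^2([0,1])}^2\big]$. For an integer $k\ge1$ and a real $C>0$ let \[ J_k(C)=\Big\{a_0+\sum_{i=1}^k a_i1_{[t_i,1]}\;:\;t_i\in(0,1],\ |a_0|\le C,\ \sum_{i=1}^k|a_i|\le C\Big\}. \] For positive integers $L,S,D$ and a real $B\ge1$ let $\mathcal N(L,S,D,B)$ be the set of functions $f:\mathbb R\to\mathbb R$ of the form $f=W_{L+1}\circ\rho(W_L\cdot-v_L)\circ\cdots\circ\rho(W_1\cdot-v_1)$ with $\rho(x)=\max\{x,0\}$ elementwise, $W_1\in\mathbb R^{D\times1}$, $W_2,\dots,W_L\in\mathbb R^{D\times D}$, $W_{L+1}\in\mathbb R^{1\times D}$, $v_1,\dots,v_L\in\mathbb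 R^D$, all entries of the $W_i$ and $v_i$ bounded by $B$ in absolute value, and at most $S$ nonzero entries in total; for $F>0$ let $\mathcal N_F(L,S,D,B)=\{\operatorname{sgn}(f)\min\{|f|,F\} : f\in\mathcal N(L,S,D,B)\}$, regarded as functions on $[0,1]$. Then for every integer $k\ge1$ and every $C>0$ there exist a constant $F>0$ and a sequence of ReLU network classes $\mathcal N^{(n)}=\mathcal N_F(L_n,S_n,D_n,B_n)$, $n\ge2$, not depending on $\sigma$, with $L_n,S_n,D_n\le C_1\log n$ and $B_n\le C_1n$ for a constant $C_1>0$ independent of $n$, such that an empirical risk minimizer over $\mathcal N^{(n)}$ (a measurable estimator $\hat f$ with values in $\mathcal N^{(n)}$ that minimizes $\frac1n\sum_{i=1}^n(Y_i-f(X_i))^2$ over $f\in\mathcal N^{(n)}$) exists for every $n\ge2$, and such that for every $\sigma>0$ there is a constant $C_3>0$, independent of $n$, for which every such empirical risk minimizer $\hat f$ satisfies \[ \sup_{f^\circ\in J_k(C)}R(\hat f,f^\circ)\le C_3\,\frac{(\log n)^3}{n}\qquad\text{for all } n\ge2. \] -/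

import Mathlib

open MeasureTheory ProbabilityTheory
open scoped ENNReal

noncomputable section

namespace ReLURegression

/-- The number of nonzero coordinates of a vector. -/
def vecNnz {m : ℕ} (v : Fin m → ℝ) : ℕ :=
  (Finset.univ.filter fun i => v i ≠ 0).card

/-- The number of nonzero entries of a matrix. -/
def matNnz {m n : ℕ} (A : Matrix (Fin m) (Fin n) ℝ) : ℕ :=
  (Finset.univ.filter fun p : Fin m × Fin n => A p.1 p.2 ≠ 0).card

/-- The ReLU activation function, applied elementwise. -/
def relu {m : ℕ} (v : Fin m → ℝ) : Fin m → ℝ := fun i => max (v i) 0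

/-- Output of the hidden layer with number `l + 1` (so `l = 0` is the first hidden layer) of the
network with first weight matrix `W₁`, further weight matrices `W 2, W 3, …` and shift vectors
`v 1, v 2, …`, at the input `x`. -/
def hiddenLayer {d D : ℕ} (W₁ : Matrix (Fin D) (Fin d) ℝ) (W : ℕ → Matrix (Fin D) (Fin D) ℝ)
    (v : ℕ → Fin D → ℝ) (x : Fin d → ℝ) : ℕ → Fin D → ℝ
  | 0 => relu (W₁.mulVec x - v 1)
  | l + 1 => relu ((W (l + 2)).mulVec (hiddenLayer W₁ W v x l) - v (l + 2))

/-- The class `𝒩(L, S, D, B)` of ReLU networks on `ℝ^d` with `L ≥ 1` hidden layers of width `D`,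
at most `S` nonzero parameters, all parameters bounded by `B` in absolute value: the functions
`W_{L+1} ∘ ρ(W_L · - v_L) ∘ ⋯ ∘ ρ(W_1 · - v_1)`. Only `W 2, …, W L` and `v 1, …, v L` matter. -/
def networks (d L S D : ℕ) (B : ℝ) : Set ((Fin d → ℝ) → ℝ) :=
  {f | ∃ (W₁ : Matrix (Fin D) (Fin d) ℝ) (W : ℕ → Matrix (Fin D) (Fin D) ℝ)
      (Wout : Matrix (Fin 1) (Fin D) ℝ) (v : ℕ → Fin D → ℝ),
      (∀ i j, |W₁ i j| ≤ B) ∧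
      (∀ l ∈ Finset.Icc 2 L, ∀ i j, |W l i j| ≤ B) ∧
      (∀ i j, |Wout i j| ≤ B) ∧
      (∀ l ∈ Finset.Icc 1 L, ∀ i, |v l i| ≤ B) ∧
      matNnz W₁ + ∑ l ∈ Finset.Icc 2 L, matNnz (W l) + matNnz Wout
        + ∑ l ∈ Finset.Icc 1 L, vecNnz (v l) ≤ S ∧
      ∀ x, f x = Wout.mulVec (hiddenLayer W₁ W v x (L - 1)) 0}

/-- Truncation of the values of a function at level `F`: `sgn(y) min(|y|, F)`. -/
def clip (F y : ℝ) : ℝ := Real.sign y * min |y| F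

/-- The class `𝒩_F(L, S, D, B)` for input dimension one, its elements being regarded as functions
on `[0, 1]`. -/
def clippedNetworks (F : ℝ) (L S D : ℕ) (B : ℝ) : Set (unitInterval → ℝ) :=
  {g | ∃ f ∈ networks 1 L S D B, ∀ x : unitInterval, g x = clip F (f fun _ => (x : ℝ))}

/-- The class `J_k(C)` of piecewise constant functions on `[0, 1]`. -/
def jumpClass (k : ℕ) (C : ℝ) : Set (unitInterval → ℝ) :=
  {f | ∃ (a₀ : ℝ) (a t : Fin k → ℝ),
      (∀ i, t i ∈ Set.Ioc (0 : ℝ) 1) ∧ |a₀| ≤ C ∧ ∑ i, |a i| ≤ C ∧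
      ∀ x : unitInterval, f x = a₀ + ∑ i, a i * (Set.Icc (t i) 1).indicator (fun _ => (1 : ℝ)) (x : ℝ)}

/-- A data set `(X_i, Y_i)`, `i = 1, …, n`, with `X_i ∈ [0, 1]` and `Y_i ∈ ℝ`. -/
abbrev Data (n : ℕ) : Type := Fin n → unitInterval × ℝ

/-- The joint law of `(X_i, ξ_i)`, `i = 1, …, n`: all independent, `X_i` uniform on `[0, 1]` and
`ξ_i` centered Gaussian with variance `σ²`. -/
def designNoiseLaw (σ : ℝ) (n : ℕ) : Measure (Fin n → unitInterval × ℝ) :=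
  Measure.pi fun _ => (volume : Measure unitInterval).prod (gaussianReal 0 (Real.toNNReal (σ ^ 2)))

/-- The data `(X_i, f₀(X_i) + ξ_i)` produced from the design points and noise `(X_i, ξ_i)`. -/
def observations {n : ℕ} (f₀ : unitInterval → ℝ) (ω : Fin n → unitInterval × ℝ) : Data n :=
  fun i => ((ω i).1, f₀ (ω i).1 + (ω i).2)

/-- The `L²` risk `E ‖f̂ - f₀‖²_{L²([0,1])}` of the estimator `f̂` when `f₀` is the true function. -/
def risk (σ : ℝ) {n : ℕ} (est : Data n → unitInterval → ℝ) (f₀ : unitInterval → ℝ) : ℝ≥0∞ :=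
  ∫⁻ ω, (∫⁻ x : unitInterval, ENNReal.ofReal ((est (observations f₀ ω) x - f₀ x) ^ 2)) ∂designNoiseLaw σ n

/-- The empirical risk of `f` on the data `z`. -/
def empiricalRisk {n : ℕ} (z : Data n) (f : unitInterval → ℝ) : ℝ :=
  (1 / (n : ℝ)) * ∑ i, ((z i).2 - f (z i).1) ^ 2

/-- `est` is an empirical risk minimizer over `𝓕`: a measurable estimator which takes values in
`𝓕` and minimizes the empirical risk over `𝓕`. -/
structure IsERM {n : ℕ} (𝓕 : Set (unitInterval → ℝ)) (est : Data n → unitInterval → ℝ) : Prop where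
  measurable : Measurable fun p : Data n × unitInterval => est p.1 p.2
  mem : ∀ z, est z ∈ 𝓕
  le : ∀ z, ∀ g ∈ 𝓕, empiricalRisk z (est z) ≤ empiricalRisk z g

end ReLURegression

end

/-! Up to a small $L^2$ error, $J_k(C)$ lies in a family with a fixed number of real parameters. So
one hidden layer of fixed width suffices, and least squares attains a risk of order $\log n/n$,
stronger than the claimed $(\log n)^3/n$. Approximation: replacing each jump by a linear ramp of
width $1/n$ costs at most $C^2/n$ in squared error and needs $2k+1$ ReLU units with weights of order
$n$ (`exists_mem_clippedNetworks_integral_sq_sub_le`). Complexity: a network depends on its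
parameters with a Lipschitz constant polynomial in $n$, so a polynomially fine parameter grid yields
a uniform $1/n$-net of log-cardinality $O(\log n)$ (`exists_gridNet_near`). Statistics
(`risk_le_of_isERM`): for bounded $h$ the excess loss $h(X)^2-2\xi h(X)$ has mean $\|h\|^2$, and for
small $\lambda$ the expectation of $\exp(-\lambda(h(X)^2-2\xi h(X)))$ is at most
$\exp(-\lambda\|h\|^2/4)$. Over $n$ samples, multiplying by $\exp(\lambda n\|h\|^2/4)$ gives
variables of mean at most one. Averaging these over the net controls the data-dependent net element
near the estimator, at the price of $\log N/\lambda$ for a net of size $N$. Only this one-sided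
bound is needed, and the Gaussian noise needs no truncation. Existence: the empirical risk is
continuous on a compact parameter cube, and a minimizer can be selected measurably
(`exists_measurable_argmin`). -/

namespace ReLURegression

/-! ### Measurable selection of minimizers -/

theorem measurableSet_exists_isMinOn {Z K : Type*} [MeasurableSpace Z] [MetricSpace K]
    [CompactSpace K] (g : Z → K → ℝ) (hm : ∀ x, Measurable fun z => g z x)
    (hc : ∀ z, Continuous (g z)) (T : Set K) (hT : IsClosed T) :
    MeasurableSet {z | ∃ x ∈ T, ∀ y, g z x ≤ g z y} := by
  rcases T.eq_empty_or_nonempty with rfl | hne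
  · simp
  have : Nonempty T := hne.to_subtype
  have : Nonempty K := hne.nonempty
  have hTc : IsCompact T := hT.isCompact
  let a : ℕ → T := TopologicalSpace.denseSeq T
  let b : ℕ → K := TopologicalSpace.denseSeq K
  -- By compactness of `T`, a global minimizer lies in `T` iff for every tolerance some point of a
  -- dense sequence of `T` is nearly optimal against a dense sequence of `K`. Only countably many
  -- conditions on `z` occur.
  have key : {z | ∃ x ∈ T, ∀ y, g z x ≤ g z y} =
      ⋂ m : ℕ, ⋃ p : ℕ, ⋂ q : ℕ, {z | g z (a p) ≤ g z (b q) + 1 / ((m : ℝ) + 1)} := by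
    ext z
    simp only [Set.mem_ofPred_eq, Set.mem_iInter, Set.mem_iUnion]
    constructor
    · rintro ⟨x, hx, hmin⟩ m
      have hε : (0 : ℝ) < 1 / ((m : ℝ) + 1) := by positivity
      have ho : IsOpen {t : T | g z t < g z x + 1 / ((m : ℝ) + 1)} :=
        isOpen_lt ((hc z).comp continuous_subtype_val) continuous_const
      obtain ⟨p, hp⟩ := (TopologicalSpace.denseRange_denseSeq T).exists_mem_open ho
        ⟨⟨x, hx⟩, by simpa using hε⟩
      refine ⟨p, fun q => ?_⟩
      have := hmin (b q)
      have hp' : g z (a p) < g z x + 1 / ((m : ℝ) + 1) := hp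
      linarith
    · intro h
      obtain ⟨x, hx, hxm⟩ := hTc.exists_isMinOn hne (hc z).continuousOn
      refine ⟨x, hx, ?_⟩
      have hb : ∀ q, g z x ≤ g z (b q) := by
        intro q
        by_contra! hlt
        obtain ⟨m, hm'⟩ := exists_nat_one_div_lt (sub_pos.2 hlt)
        obtain ⟨p, hp⟩ := h m
        have h1 := hp q
        have h2 : g z x ≤ g z (a p) := hxm (a p).2
        linarith
      have hcl : IsClosed {y | g z x ≤ g z y} := isClosed_le continuous_const (hc z)
      intro y
      exact (hcl.closure_subset_iff.2 (Set.range_subset_iff.2 hb))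
        ((TopologicalSpace.denseRange_denseSeq K) y)
  rw [key]
  refine MeasurableSet.iInter fun m => MeasurableSet.iUnion fun p => MeasurableSet.iInter fun q => ?_
  exact measurableSet_le (hm _) ((hm _).add_const _)

/-- A compact metric space is a continuous image of the Cantor set, which is a compact subset of the
line. There the least minimizer is a canonical choice, and it is at most `c` exactly when some
minimizer lies in the closed part below `c`. -/
theorem exists_measurable_argmin {Z Θ : Type*} [MeasurableSpace Z] [MetricSpace Θ]
    [CompactSpace Θ] [Nonempty Θ] [MeasurableSpace Θ] [BorelSpace Θ] (g : Z → Θ → ℝ)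
    (hm : ∀ x, Measurable fun z => g z x) (hc : ∀ z, Continuous (g z)) :
    ∃ s : Z → Θ, Measurable s ∧ ∀ z x, g z (s z) ≤ g z x := by
  obtain ⟨φ, hφ, hsurj⟩ := exists_nat_bool_continuous_surjective_of_compact Θ
  let ψ : cantorSet → Θ := φ ∘ cantorSetHomeomorphNatToBool
  have hψ : Continuous ψ := hφ.comp cantorSetHomeomorphNatToBool.continuous
  have hψs : Function.Surjective ψ := hsurj.comp cantorSetHomeomorphNatToBool.surjective
  have : CompactSpace cantorSet := isCompact_iff_compactSpace.1 isCompact_cantorSet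
  have : Nonempty cantorSet := ⟨⟨0, zero_mem_cantorSet⟩⟩
  have hGc : ∀ z, Continuous fun x => g z (ψ x) := fun z => (hc z).comp hψ
  have hex : ∀ z, ∃ x : cantorSet, IsLeast {x : cantorSet | ∀ y, g z (ψ x) ≤ g z (ψ y)} x := by
    intro z
    have hcl : IsClosed {x : cantorSet | ∀ y, g z (ψ x) ≤ g z (ψ y)} := by
      simp only [Set.ofPred_forall]
      exact isClosed_iInter fun y => isClosed_le (hGc z) continuous_const
    refine hcl.isCompact.exists_isLeast ?_
    obtain ⟨x, -, hx⟩ := isCompact_univ.exists_isMinOn Set.univ_nonempty (hGc z).continuousOn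
    exact ⟨x, fun y => hx (Set.mem_univ y)⟩
  choose s hs using hex
  have hsm : Measurable fun z => (s z : ℝ) := by
    refine measurable_of_Iic fun c => ?_
    have : (fun z => (s z : ℝ)) ⁻¹' Set.Iic c =
        {z | ∃ x ∈ {x : cantorSet | (x : ℝ) ≤ c}, ∀ y, g z (ψ x) ≤ g z (ψ y)} := by
      ext z
      constructor
      · intro h
        exact ⟨s z, h, (hs z).1⟩
      · rintro ⟨x, hx, hmin⟩
        exact le_trans (Subtype.coe_le_coe.2 ((hs z).2 hmin)) hx
    rw [this]
    exact measurableSet_exists_isMinOn (fun z x => g z (ψ x)) (fun x => hm _) hGc _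
      (isClosed_le continuous_subtype_val continuous_const)
  refine ⟨fun z => ψ (s z), hψ.measurable.comp (hsm.subtype_mk), fun z x => ?_⟩
  obtain ⟨y, rfl⟩ := hψs x
  exact (hs z).1 y

/-! ### Clipped shallow networks and existence of empirical risk minimizers -/

theorem clip_eq_max_min {F : ℝ} (hF : 0 < F) (y : ℝ) : clip F y = max (-F) (min y F) := by
  unfold clip
  rcases lt_trichotomy y 0 with h | rfl | h
  · rw [Real.sign_of_neg h, abs_of_neg h, min_eq_left (a := y) (by linarith), neg_one_mul,
      ← max_neg_neg, neg_neg, max_comm]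
  · simp [hF.le]
  · rw [Real.sign_of_pos h, abs_of_pos h, one_mul, max_eq_right]
    exact le_min (by linarith) (by linarith)

theorem continuous_clip {F : ℝ} (hF : 0 < F) : Continuous (clip F) := by
  rw [funext (clip_eq_max_min hF)]
  fun_prop

theorem abs_clip_le {F : ℝ} (hF : 0 < F) (y : ℝ) : |clip F y| ≤ F := by
  rw [clip_eq_max_min hF, abs_le]
  exact ⟨le_max_left _ _, max_le (by linarith) (min_le_right _ _)⟩

theorem clip_of_abs_le {F : ℝ} (hF : 0 < F) {y : ℝ} (hy : |y| ≤ F) : clip F y = y := by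
  rw [abs_le] at hy
  rw [clip_eq_max_min hF, min_eq_left hy.2, max_eq_right hy.1]

theorem abs_clip_sub_clip_le {F : ℝ} (hF : 0 < F) (x y : ℝ) :
    |clip F x - clip F y| ≤ |x - y| := by
  rw [clip_eq_max_min hF, clip_eq_max_min hF, max_comm (-F), max_comm (-F)]
  exact (abs_max_sub_max_le_abs _ _ _).trans (abs_inf_sub_inf_le_abs x y F)

/-- The network with one hidden layer of width `D` whose first weight matrix, shift vector and
output weights are `θ (0, ·)`, `θ (1, ·)` and `θ (2, ·)`. -/
def shallowNet {D : ℕ} (θ : Fin 3 × Fin D → ℝ) (x : ℝ) : ℝ :=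
  ∑ d, θ (2, d) * max (θ (0, d) * x - θ (1, d)) 0

/-- The parameters of shallow networks bounded by `B` in absolute value. -/
abbrev paramCube (D : ℕ) (B : ℝ) : Set (Fin 3 × Fin D → ℝ) :=
  Set.Icc (fun _ => -B) (fun _ => B)

theorem mem_paramCube {D : ℕ} {B : ℝ} {θ : Fin 3 × Fin D → ℝ} :
    θ ∈ paramCube D B ↔ ∀ i, |θ i| ≤ B := by
  simp only [Set.mem_Icc, Pi.le_def, abs_le, forall_and]

theorem continuous_shallowNet {D : ℕ} :
    Continuous fun p : (Fin 3 × Fin D → ℝ) × ℝ => shallowNet p.1 p.2 := by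
  unfold shallowNet
  fun_prop

theorem matNnz_le {m n : ℕ} (A : Matrix (Fin m) (Fin n) ℝ) : matNnz A ≤ m * n := by
  refine (Finset.card_filter_le _ _).trans ?_
  simp

theorem vecNnz_le {m : ℕ} (v : Fin m → ℝ) : vecNnz v ≤ m := by
  refine (Finset.card_filter_le _ _).trans ?_
  simp

/-- One hidden layer with scalar input has exactly `3 * D` parameters, so with `S = 3 * D` the
sparsity constraint is vacuous and the class is the image of a compact cube. -/
theorem mem_clippedNetworks_one_iff {F B : ℝ} {D : ℕ} {g : unitInterval → ℝ} :
    g ∈ clippedNetworks F 1 (3 * D) D B ↔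
      ∃ θ ∈ paramCube D B, ∀ x : unitInterval, g x = clip F (shallowNet θ x) := by
  constructor
  · rintro ⟨f, ⟨W₁, W, Wout, v, h1, -, h3, h4, -, hf⟩, hg⟩
    refine ⟨fun p => ![W₁ p.2 0, v 1 p.2, Wout 0 p.2] p.1, ?_, fun x => ?_⟩
    · rw [mem_paramCube]
      rintro ⟨i, d⟩
      have := h4 1 (by simp) d
      fin_cases i <;> simp [h1, h3, this]
    · rw [hg, hf]
      simp [shallowNet, hiddenLayer, relu, Matrix.mulVec, dotProduct]
  · rintro ⟨θ, hθ, hg⟩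
    rw [mem_paramCube] at hθ
    refine ⟨fun x => shallowNet θ (x 0), ⟨fun d _ => θ (0, d), 0, fun _ d => θ (2, d),
      fun _ d => θ (1, d), fun _ _ => hθ _, by simp, fun _ _ => hθ _, fun _ _ _ => hθ _, ?_, ?_⟩, ?_⟩
    · have h1 := matNnz_le (m := D) (n := 1) (fun d _ => θ (0, d))
      have h2 := matNnz_le (m := 1) (n := D) (fun _ d => θ (2, d))
      have h3 := vecNnz_le (fun d => θ (1, d))
      simp
      omega
    · intro x
      simp [shallowNet, hiddenLayer, relu, Matrix.mulVec, dotProduct]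
    · exact hg

theorem exists_isERM_range {Θ : Type*} [MetricSpace Θ] [CompactSpace Θ] [Nonempty Θ]
    [MeasurableSpace Θ] [BorelSpace Θ] {G : Θ × unitInterval → ℝ} (hG : Continuous G) (n : ℕ) :
    ∃ est : Data n → unitInterval → ℝ, IsERM (Set.range fun θ x => G (θ, x)) est := by
  obtain ⟨s, hs, hmin⟩ := exists_measurable_argmin
    (fun (z : Data n) (θ : Θ) => empiricalRisk z fun x => G (θ, x))
    (fun θ => by
      unfold empiricalRisk
      refine Measurable.const_mul (Finset.measurable_sum _ fun i _ => ?_) _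
      have h1 : Measurable fun x : unitInterval => G (θ, x) :=
        (hG.comp (Continuous.prodMk_right θ)).measurable
      have h2 : Measurable fun z : Data n => (z i).1 := by fun_prop
      have h3 : Measurable fun z : Data n => (z i).2 := by fun_prop
      exact (h3.sub (h1.comp h2)).pow_const 2)
    (fun z => by
      unfold empiricalRisk
      refine continuous_const.mul (continuous_finsetSum _ fun i _ => ?_)
      have h1 := hG.comp (Continuous.prodMk_left (z i).1)
      exact (continuous_const.sub h1).pow 2)
  refine ⟨fun z x => G (s z, x), ?_, fun z => ⟨s z, rfl⟩, ?_⟩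
  · exact hG.measurable.comp ((hs.comp measurable_fst).prodMk measurable_snd)
  · rintro z g ⟨θ, rfl⟩
    exact hmin z θ

theorem exists_isERM_clippedNetworks {F B : ℝ} (hF : 0 < F) (hB : 0 ≤ B) (D n : ℕ) :
    ∃ est : Data n → unitInterval → ℝ, IsERM (clippedNetworks F 1 (3 * D) D B) est := by
  have : Nonempty (paramCube D B) := ⟨⟨0, mem_paramCube.2 fun _ => by simpa using hB⟩⟩
  have hpair : Continuous fun p : paramCube D B × unitInterval =>
      ((p.1 : Fin 3 × Fin D → ℝ), (p.2 : ℝ)) := by fun_prop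
  have hcont : Continuous fun p : paramCube D B × unitInterval =>
      clip F (shallowNet (p.1 : Fin 3 × Fin D → ℝ) p.2) :=
    (continuous_clip hF).comp (continuous_shallowNet.comp hpair)
  obtain ⟨est, hest⟩ := exists_isERM_range hcont n
  refine ⟨est, ?_⟩
  convert hest
  ext g
  rw [mem_clippedNetworks_one_iff]
  constructor
  · rintro ⟨θ, hθ, hg⟩
    exact ⟨⟨θ, hθ⟩, (funext hg).symm⟩
  · rintro ⟨θ, rfl⟩
    exact ⟨θ, θ.2, fun _ => rfl⟩

/-! ### Moments and exponential moments of the excess loss -/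

/-- The joint law of one design point and one noise variable. -/
noncomputable abbrev pairLaw (σ : ℝ) : Measure (unitInterval × ℝ) :=
  (volume : Measure unitInterval).prod (gaussianReal 0 (Real.toNNReal (σ ^ 2)))

theorem integrable_exp_abs_mul_gaussianReal (σ t : ℝ) :
    Integrable (fun y => Real.exp (t * |y|)) (gaussianReal 0 (Real.toNNReal (σ ^ 2))) := by
  refine ((integrable_exp_mul_gaussianReal t).add (integrable_exp_mul_gaussianReal (-t))).mono'
    (by fun_prop) (ae_of_all _ fun y => ?_)
  have h1 := Real.exp_pos (t * y)
  have h2 := Real.exp_pos (-t * y)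
  rw [Real.norm_eq_abs, Real.abs_exp]
  rcases abs_choice y with h | h <;> rw [h]
  · exact le_add_of_nonneg_right h2.le
  · rw [mul_neg, ← neg_mul]
    exact le_add_of_nonneg_left h1.le

theorem integral_exp_mul_gaussianReal (σ t : ℝ) :
    ∫ y, Real.exp (t * y) ∂gaussianReal 0 (Real.toNNReal (σ ^ 2)) =
      Real.exp (σ ^ 2 * t ^ 2 / 2) := by
  have := congrFun (mgf_fun_id_gaussianReal (μ := 0) (v := Real.toNNReal (σ ^ 2))) t
  simpa [mgf, Real.coe_toNNReal _ (sq_nonneg σ)] using this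

theorem integrable_of_abs_le {h : unitInterval → ℝ} (hm : Measurable h) {M : ℝ}
    (hM : ∀ x, |h x| ≤ M) : Integrable h :=
  Integrable.of_bound hm.aestronglyMeasurable M (ae_of_all _ hM)

theorem integrable_sq_of_abs_le {h : unitInterval → ℝ} (hm : Measurable h) {M : ℝ}
    (hM : ∀ x, |h x| ≤ M) : Integrable fun x => h x ^ 2 :=
  integrable_of_abs_le (hm.pow_const 2) (M := M ^ 2) fun x => by
    rw [abs_pow]
    exact pow_le_pow_left₀ (abs_nonneg _) (hM x) 2

theorem integrable_exp_excessLoss {σ lam M : ℝ} (hlam : 0 ≤ lam) {h : unitInterval → ℝ}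
    (hm : Measurable h) (hM : ∀ x, |h x| ≤ M) :
    Integrable (fun p : unitInterval × ℝ => Real.exp (-(lam * (h p.1 ^ 2 - 2 * p.2 * h p.1))))
      (pairLaw σ) := by
  refine ((integrable_exp_abs_mul_gaussianReal σ (2 * lam * M)).comp_snd
    (volume : Measure unitInterval)).mono' ?_ (ae_of_all _ fun p => ?_)
  · have : Measurable fun p : unitInterval × ℝ => h p.1 := hm.comp measurable_fst
    exact (by fun_prop : Measurable _).aestronglyMeasurable
  · rw [Real.norm_eq_abs, Real.abs_exp, Real.exp_le_exp]
    have h1 : p.2 * h p.1 ≤ |p.2| * M := (le_abs_self _).trans <| by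
      rw [abs_mul]
      exact mul_le_mul_of_nonneg_left (hM _) (abs_nonneg _)
    have h2 := mul_le_mul_of_nonneg_left h1 hlam
    have h3 : 0 ≤ lam * h p.1 ^ 2 := by positivity
    nlinarith

/-- Integrating out the noise gives $\exp(-\lambda h^2+2\sigma^2\lambda^2h^2)\le e^{-u}$ with
$u=\lambda h^2/2\le 1/2$. Then $e^{-u}\le 1-u+u^2\le 1-u/2$, and integrating over the design
followed by $1+y\le e^y$ puts the mean of $h^2$ in the exponent. -/
theorem integral_exp_excessLoss_le {σ lam M : ℝ} (hlam : 0 ≤ lam) (hσ : 4 * lam * σ ^ 2 ≤ 1)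
    (hlM : lam * M ^ 2 ≤ 1) {h : unitInterval → ℝ} (hm : Measurable h) (hM : ∀ x, |h x| ≤ M) :
    ∫ p, Real.exp (-(lam * (h p.1 ^ 2 - 2 * p.2 * h p.1))) ∂pairLaw σ ≤
      Real.exp (-(lam * ((∫ x, h x ^ 2) / 4))) := by
  rw [integral_prod _ (integrable_exp_excessLoss hlam hm hM)]
  have hsq := integrable_sq_of_abs_le hm hM
  have hinner : ∀ x, ∫ y, Real.exp (-(lam * (h x ^ 2 - 2 * y * h x)))
      ∂gaussianReal 0 (Real.toNNReal (σ ^ 2)) ≤ 1 - lam / 4 * h x ^ 2 := by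
    intro x
    have h1 : ∀ y, Real.exp (-(lam * (h x ^ 2 - 2 * y * h x))) =
        Real.exp (-(lam * h x ^ 2)) * Real.exp (2 * lam * h x * y) := by
      intro y
      rw [← Real.exp_add]
      ring_nf
    simp_rw [h1]
    rw [integral_const_mul, integral_exp_mul_gaussianReal, ← Real.exp_add]
    have hx2 : h x ^ 2 ≤ M ^ 2 := sq_le_sq.2 ((hM x).trans (le_abs_self M))
    have hu : 0 ≤ lam * h x ^ 2 := by positivity
    have hu2 : lam * h x ^ 2 ≤ 1 := (mul_le_mul_of_nonneg_left hx2 hlam).trans hlM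
    have h2 : -(lam * h x ^ 2) + σ ^ 2 * (2 * lam * h x) ^ 2 / 2 ≤ -(lam * h x ^ 2 / 2) := by
      nlinarith [mul_le_mul_of_nonneg_right hσ hu]
    refine (Real.exp_le_exp.2 h2).trans ?_
    have h3 := Real.abs_exp_sub_one_sub_id_le (x := -(lam * h x ^ 2 / 2))
      (by rw [abs_neg, abs_of_nonneg (by positivity)]; linarith)
    have h4 := (abs_le.1 h3).2
    nlinarith
  refine (integral_mono_of_nonneg (ae_of_all _ fun x => integral_nonneg fun y => (Real.exp_pos _).le)
    ((integrable_const _).sub (hsq.const_mul _)) (ae_of_all _ hinner)).trans ?_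
  simp only [Pi.sub_apply]
  rw [integral_sub (integrable_const _) (hsq.const_mul _), integral_const_mul]
  have := Real.add_one_le_exp (-(lam * ((∫ x, h x ^ 2) / 4)))
  simp
  linarith

theorem exp_neg_sum_eq_prod {n : ℕ} (lam : ℝ) (h : unitInterval → ℝ) (ω : Fin n → unitInterval × ℝ) :
    Real.exp (-(lam * ∑ i, (h (ω i).1 ^ 2 - 2 * (ω i).2 * h (ω i).1))) =
      ∏ i, Real.exp (-(lam * (h (ω i).1 ^ 2 - 2 * (ω i).2 * h (ω i).1))) := by
  rw [← Real.exp_sum, Finset.mul_sum, Finset.sum_neg_distrib]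

theorem integrable_exp_sum_excessLoss {σ lam M : ℝ} (n : ℕ) (hlam : 0 ≤ lam)
    {h : unitInterval → ℝ} (hm : Measurable h) (hM : ∀ x, |h x| ≤ M) :
    Integrable (fun ω => Real.exp (-(lam * ∑ i, (h (ω i).1 ^ 2 - 2 * (ω i).2 * h (ω i).1))))
      (designNoiseLaw σ n) := by
  simp_rw [exp_neg_sum_eq_prod]
  exact Integrable.fintype_prod (f := fun _ p => _) (μ := fun _ => pairLaw σ)
    fun _ => integrable_exp_excessLoss hlam hm hM

theorem integral_exp_sum_excessLoss_le {σ lam M : ℝ} (n : ℕ) (hlam : 0 ≤ lam)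
    (hσ : 4 * lam * σ ^ 2 ≤ 1) (hlM : lam * M ^ 2 ≤ 1)
    {h : unitInterval → ℝ} (hm : Measurable h) (hM : ∀ x, |h x| ≤ M) :
    ∫ ω, Real.exp (-(lam * ∑ i, (h (ω i).1 ^ 2 - 2 * (ω i).2 * h (ω i).1))) ∂designNoiseLaw σ n ≤
      Real.exp (-(lam * (n * (∫ x, h x ^ 2) / 4))) := by
  simp_rw [exp_neg_sum_eq_prod]
  unfold designNoiseLaw
  rw [integral_fintype_prod_eq_pow (μ := pairLaw σ)
    (fun p => Real.exp (-(lam * (h p.1 ^ 2 - 2 * p.2 * h p.1))))]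
  refine (pow_le_pow_left₀ (integral_nonneg fun p => (Real.exp_pos _).le)
    (integral_exp_excessLoss_le hlam hσ hlM hm hM) _).trans_eq ?_
  rw [← Real.exp_nat_mul, Fintype.card_fin]
  ring_nf

instance (σ : ℝ) (n : ℕ) : IsProbabilityMeasure (designNoiseLaw σ n) := by
  unfold designNoiseLaw
  infer_instance

theorem integrable_sq_gaussianReal (σ : ℝ) :
    Integrable (fun y => y ^ 2) (gaussianReal 0 (Real.toNNReal (σ ^ 2))) :=
  (memLp_id_gaussianReal 2).integrable_sq

theorem integral_sq_gaussianReal (σ : ℝ) :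
    ∫ y, y ^ 2 ∂gaussianReal 0 (Real.toNNReal (σ ^ 2)) = σ ^ 2 := by
  have h := variance_of_integral_eq_zero (X := fun y : ℝ => y)
    (μ := gaussianReal 0 (Real.toNNReal (σ ^ 2))) (by fun_prop) (by simp)
  rw [variance_fun_id_gaussianReal, Real.coe_toNNReal _ (sq_nonneg σ)] at h
  exact h.symm

theorem integrable_excessLoss {σ M : ℝ} {h : unitInterval → ℝ} (hm : Measurable h)
    (hM : ∀ x, |h x| ≤ M) :
    Integrable (fun p : unitInterval × ℝ => h p.1 ^ 2 - 2 * p.2 * h p.1) (pairLaw σ) := by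
  have h1 : Integrable (fun y : ℝ => y) (gaussianReal 0 (Real.toNNReal (σ ^ 2))) :=
    memLp_one_iff_integrable.1 (memLp_id_gaussianReal 1)
  have h2 := (integrable_of_abs_le hm hM).mul_prod h1
  have h3 := (integrable_sq_of_abs_le hm hM).comp_fst
    (gaussianReal 0 (Real.toNNReal (σ ^ 2)))
  exact (h3.sub (h2.const_mul 2)).congr (ae_of_all _ fun p => by simp; ring)

theorem integral_excessLoss {σ M : ℝ} {h : unitInterval → ℝ} (hm : Measurable h)
    (hM : ∀ x, |h x| ≤ M) :
    ∫ p, (h p.1 ^ 2 - 2 * p.2 * h p.1) ∂pairLaw σ = ∫ x, h x ^ 2 := by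
  rw [integral_prod _ (integrable_excessLoss hm hM)]
  refine integral_congr_ae (ae_of_all _ fun x => ?_)
  have h1 : Integrable (fun y : ℝ => y) (gaussianReal 0 (Real.toNNReal (σ ^ 2))) :=
    memLp_one_iff_integrable.1 (memLp_id_gaussianReal 1)
  simp only
  rw [integral_sub (integrable_const _) ((h1.const_mul 2).mul_const _), integral_mul_const,
    integral_const_mul, integral_id_gaussianReal]
  simp

theorem integrable_sum_comp_eval {σ : ℝ} (n : ℕ) {φ : unitInterval × ℝ → ℝ}
    (hφ : Integrable φ (pairLaw σ)) :
    Integrable (fun ω => ∑ i, φ (ω i)) (designNoiseLaw σ n) :=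
  integrable_finsetSum _ fun _ _ => integrable_comp_eval (μ := fun _ => pairLaw σ) hφ

theorem integral_sum_comp_eval {σ : ℝ} (n : ℕ) {φ : unitInterval × ℝ → ℝ}
    (hφ : Integrable φ (pairLaw σ)) :
    ∫ ω, ∑ i, φ (ω i) ∂designNoiseLaw σ n = n * ∫ p, φ p ∂pairLaw σ := by
  unfold designNoiseLaw
  rw [integral_finsetSum _ fun _ _ => integrable_comp_eval (μ := fun _ => pairLaw σ) hφ]
  simp_rw [integral_comp_eval (μ := fun _ => pairLaw σ) hφ.aestronglyMeasurable]
  simp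

/-! ### Oracle inequality for empirical risk minimizers -/

/-- With $h=u-f_0$ the squared residual is $(\xi-h)^2=\xi^2+(h^2-2\xi h)$, and the term $\xi^2$ is
common to all candidates. -/
theorem sum_excessLoss_le_of_empiricalRisk_le {n : ℕ} (hn : 0 < n) (f₀ f g : unitInterval → ℝ)
    (ω : Fin n → unitInterval × ℝ)
    (h : empiricalRisk (observations f₀ ω) f ≤ empiricalRisk (observations f₀ ω) g) :
    ∑ i, ((f (ω i).1 - f₀ (ω i).1) ^ 2 - 2 * (ω i).2 * (f (ω i).1 - f₀ (ω i).1)) ≤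
      ∑ i, ((g (ω i).1 - f₀ (ω i).1) ^ 2 - 2 * (ω i).2 * (g (ω i).1 - f₀ (ω i).1)) := by
  have key : ∀ u : unitInterval → ℝ, empiricalRisk (observations f₀ ω) u = 1 / (n : ℝ) *
      (∑ i, ((u (ω i).1 - f₀ (ω i).1) ^ 2 - 2 * (ω i).2 * (u (ω i).1 - f₀ (ω i).1)) +
        ∑ i, (ω i).2 ^ 2) := by
    intro u
    rw [← Finset.sum_add_distrib]
    unfold empiricalRisk observations
    congr 1
    refine Finset.sum_congr rfl fun i _ => ?_
    simp only
    ring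
  rw [key, key] at h
  have hn' : (0 : ℝ) < 1 / (n : ℝ) := by positivity
  have := le_of_mul_le_mul_left h hn'
  linarith

theorem excessLoss_le_add {F δ a b c ξ : ℝ} (ha : |a| ≤ F) (hb : |b| ≤ F) (hc : |c| ≤ F)
    (hab : |b - a| ≤ δ) :
    (a - c) ^ 2 - 2 * ξ * (a - c) ≤
      (b - c) ^ 2 - 2 * ξ * (b - c) + δ * (4 * F + 1 + ξ ^ 2) := by
  have h1 : (a - c) ^ 2 - 2 * ξ * (a - c) - ((b - c) ^ 2 - 2 * ξ * (b - c)) =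
      (a - b) * (a + b - 2 * c - 2 * ξ) := by ring
  have h2 : |a + b - 2 * c - 2 * ξ| ≤ 4 * F + 1 + ξ ^ 2 := by
    rw [abs_le] at *
    constructor <;> nlinarith [sq_nonneg (ξ - 1), sq_nonneg (ξ + 1)]
  have h3 : (a - b) * (a + b - 2 * c - 2 * ξ) ≤ δ * (4 * F + 1 + ξ ^ 2) := by
    refine (le_abs_self _).trans ?_
    rw [abs_mul, abs_sub_comm]
    exact mul_le_mul hab h2 (abs_nonneg _) ((abs_nonneg _).trans hab)
  linarith

/-- This is $1+t\le e^t$ at $t=x_j-\log N$. The right side no longer depends on `j` and is linear in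
the exponentials, so it stays usable when `j` is random and an expectation is taken. -/
theorem le_log_card_add_average {ι : Type*} [Fintype ι] (x : ι → ℝ) (j : ι) :
    x j ≤ Real.log (Fintype.card ι) + ((∑ i, Real.exp (x i)) / Fintype.card ι - 1) := by
  have : Nonempty ι := ⟨j⟩
  have hN : (0 : ℝ) < Fintype.card ι := by exact_mod_cast Fintype.card_pos
  have h1 := Real.add_one_le_exp (x j - Real.log (Fintype.card ι))
  rw [Real.exp_sub, Real.exp_log hN] at h1
  have h2 : Real.exp (x j) ≤ ∑ i, Real.exp (x i) :=
    Finset.single_le_sum (fun i _ => (Real.exp_pos (x i)).le) (Finset.mem_univ j)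
  have h3 := div_le_div_of_nonneg_right h2 hN.le
  linarith

theorem lintegral_sq_sub_le {f g f₀ : unitInterval → ℝ} {M δ : ℝ} (hg : Measurable g)
    (hf₀ : Measurable f₀) (hM : ∀ x, |g x - f₀ x| ≤ M) (hfg : ∀ x, |f x - g x| ≤ δ) :
    ∫⁻ x : unitInterval, ENNReal.ofReal ((f x - f₀ x) ^ 2) ≤
      ENNReal.ofReal (2 * (∫ x, (g x - f₀ x) ^ 2) + 2 * δ ^ 2) := by
  have hint : Integrable fun x => (g x - f₀ x) ^ 2 := integrable_sq_of_abs_le (hg.sub hf₀) hM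
  have hint2 : Integrable fun x : unitInterval => 2 * (g x - f₀ x) ^ 2 + 2 * δ ^ 2 :=
    (hint.const_mul 2).add (integrable_const _)
  have h1 : ∫ x : unitInterval, (2 * (g x - f₀ x) ^ 2 + 2 * δ ^ 2) =
      2 * (∫ x, (g x - f₀ x) ^ 2) + 2 * δ ^ 2 := by
    rw [integral_add (hint.const_mul 2) (integrable_const _), integral_const_mul]
    simp
  rw [← h1, ofReal_integral_eq_lintegral_ofReal hint2 (ae_of_all _ fun x => by positivity)]
  refine lintegral_mono fun x => ENNReal.ofReal_le_ofReal ?_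
  have := sq_le_sq.2 ((hfg x).trans (le_abs_self δ))
  nlinarith [sq_nonneg ((f x - g x) - (g x - f₀ x))]

/-- Oracle inequality for empirical risk minimizers over a class of functions bounded by `F` that
has a finite uniform `δ`-net `N`. -/
theorem risk_le_of_isERM {σ F δ : ℝ} (hσ : 0 < σ) (hF : 0 < F) {n : ℕ}
    (hn : 0 < n) {𝓕 : Set (unitInterval → ℝ)} {ι : Type*} [Fintype ι] (N : ι → unitInterval → ℝ)
    (hNm : ∀ i, Measurable (N i)) (hNF : ∀ i x, |N i x| ≤ F) (h𝓕 : ∀ g ∈ 𝓕, ∀ x, |g x| ≤ F)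
    (hnet : ∀ g ∈ 𝓕, ∃ i, ∀ x, |g x - N i x| ≤ δ) {f₀ : unitInterval → ℝ} (hf₀ : Measurable f₀)
    (hf₀F : ∀ x, |f₀ x| ≤ F) {f : unitInterval → ℝ} (hf : f ∈ 𝓕) (hfm : Measurable f)
    {est : Data n → unitInterval → ℝ} (hest : IsERM 𝓕 est) :
    risk σ est f₀ ≤ ENNReal.ofReal (2 * δ ^ 2 + 8 * (∫ x, (f x - f₀ x) ^ 2) +
      8 * δ * (4 * F + 1 + σ ^ 2) +
        8 * (4 * σ ^ 2 + 4 * F ^ 2) * Real.log (Fintype.card ι) / n) := by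
  have : Nonempty ι := ⟨(hnet f hf).choose⟩
  have hn' : (0 : ℝ) < n := by exact_mod_cast hn
  have hN : (0 : ℝ) < Fintype.card ι := by exact_mod_cast Fintype.card_pos
  -- The value meets both requirements of the exponential moment bound, $4\lambda\sigma^2\le1$ and
  -- $\lambda(2F)^2\le1$, where $2F$ bounds the difference of two functions bounded by $F$.
  obtain ⟨lam, hlam_def⟩ : ∃ lam : ℝ, lam = 1 / (4 * σ ^ 2 + 4 * F ^ 2) := ⟨_, rfl⟩
  have hden : 0 < 4 * σ ^ 2 + 4 * F ^ 2 := by positivity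
  have hlam : 0 < lam := by rw [hlam_def]; positivity
  have hlσ : 4 * lam * σ ^ 2 ≤ 1 := by
    rw [hlam_def, mul_one_div, div_mul_eq_mul_div, div_le_one hden]
    nlinarith [sq_nonneg F]
  have hlM : lam * (2 * F) ^ 2 ≤ 1 := by
    rw [hlam_def, one_div_mul_eq_div, div_le_one hden]
    nlinarith [sq_nonneg σ]
  have hsubF : ∀ g : unitInterval → ℝ, (∀ x, |g x| ≤ F) → ∀ x, |g x - f₀ x| ≤ 2 * F := by
    intro g hg x
    have := abs_sub (g x) (f₀ x)
    linarith [hg x, hf₀F x]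
  let loss : (unitInterval → ℝ) → unitInterval × ℝ → ℝ :=
    fun g p => (g p.1 - f₀ p.1) ^ 2 - 2 * p.2 * (g p.1 - f₀ p.1)
  let q : ι → ℝ := fun j => ∫ x, (N j x - f₀ x) ^ 2
  -- Normalized so that each `e j` has mean at most one.
  let e : ι → (Fin n → unitInterval × ℝ) → ℝ :=
    fun j ω => Real.exp (lam * (n * q j / 4)) * Real.exp (-(lam * ∑ i, loss (N j) (ω i)))
  have he_int : ∀ j, Integrable (e j) (designNoiseLaw σ n) := fun j =>
    (integrable_exp_sum_excessLoss n hlam.le ((hNm j).sub hf₀) (hsubF _ (hNF j))).const_mul _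
  have he_le : ∀ j, ∫ ω, e j ω ∂designNoiseLaw σ n ≤ 1 := by
    intro j
    have h1 := integral_exp_sum_excessLoss_le (σ := σ) n hlam.le hlσ hlM ((hNm j).sub hf₀)
      (hsubF _ (hNF j))
    have h2 := mul_le_mul_of_nonneg_left h1 (Real.exp_pos (lam * (n * q j / 4))).le
    rw [← integral_const_mul, ← Real.exp_add] at h2
    refine h2.trans_eq ?_
    rw [Real.exp_eq_one_iff]
    simp [q]
  have hloss_int : Integrable (loss f) (pairLaw σ) :=
    integrable_excessLoss (hfm.sub hf₀) (hsubF _ (h𝓕 f hf))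
  have hnoise_int : Integrable (fun p : unitInterval × ℝ => δ * (4 * F + 1 + p.2 ^ 2))
      (pairLaw σ) :=
    ((integrable_const _).add ((integrable_sq_gaussianReal σ).comp_snd _)).const_mul _
  -- Dominates the loss whichever net element is near the estimator. The factor `8 / n` turns `n * q
  -- j / 4` into `2 * q j`, the form in which `lintegral_sq_sub_le` passes from the net element to
  -- the estimator.
  let bound : (Fin n → unitInterval × ℝ) → ℝ := fun ω => 2 * δ ^ 2 + 8 / n *
    (∑ i, loss f (ω i) + ∑ i, δ * (4 * F + 1 + (ω i).2 ^ 2) +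
      (4 * σ ^ 2 + 4 * F ^ 2) * (Real.log (Fintype.card ι) + ((∑ j, e j ω) / Fintype.card ι - 1)))
  have hpoint : ∀ ω, ∃ j, 2 * q j + 2 * δ ^ 2 ≤ bound ω ∧
      ∀ x, |est (observations f₀ ω) x - N j x| ≤ δ := by
    intro ω
    obtain ⟨j, hj⟩ := hnet _ (hest.mem (observations f₀ ω))
    refine ⟨j, ?_, hj⟩
    have h1 := sum_excessLoss_le_of_empiricalRisk_le hn f₀ _ f ω (hest.le _ f hf)
    have h2 : ∑ i, loss (N j) (ω i) ≤ ∑ i, (loss (est (observations f₀ ω)) (ω i) +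
        δ * (4 * F + 1 + (ω i).2 ^ 2)) :=
      Finset.sum_le_sum fun i _ => excessLoss_le_add (hNF j _) (h𝓕 _ (hest.mem _) _) (hf₀F _)
        (hj _)
    rw [Finset.sum_add_distrib] at h2
    have h3 := le_log_card_add_average
      (fun j => lam * (n * q j / 4) + -(lam * ∑ i, loss (N j) (ω i))) j
    simp only [Real.exp_add] at h3
    change _ ≤ Real.log (Fintype.card ι) + ((∑ j, e j ω) / Fintype.card ι - 1) at h3
    have h4 : (4 * σ ^ 2 + 4 * F ^ 2) * lam = 1 := by
      rw [hlam_def, mul_one_div, div_self hden.ne']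
    have h5 := mul_le_mul_of_nonneg_left h3 hden.le
    have h6 : (4 * σ ^ 2 + 4 * F ^ 2) *
        (lam * (n * q j / 4) + -(lam * ∑ i, loss (N j) (ω i))) =
        n * q j / 4 - ∑ i, loss (N j) (ω i) := by
      linear_combination (n * q j / 4 - ∑ i, loss (N j) (ω i)) * h4
    rw [h6] at h5
    have h7 : n * q j / 4 ≤ ∑ i, loss f (ω i) + ∑ i, δ * (4 * F + 1 + (ω i).2 ^ 2) +
        (4 * σ ^ 2 + 4 * F ^ 2) *
          (Real.log (Fintype.card ι) + ((∑ j, e j ω) / Fintype.card ι - 1)) := by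
      have h1' : ∑ i, loss (est (observations f₀ ω)) (ω i) ≤ ∑ i, loss f (ω i) := h1
      linarith
    have h8 := mul_le_mul_of_nonneg_left h7 (by positivity : 0 ≤ 8 / (n : ℝ))
    have h9 : 8 / (n : ℝ) * (n * q j / 4) = 2 * q j := by field_simp; ring
    rw [h9] at h8
    change _ ≤ 2 * δ ^ 2 + 8 / n * _
    linarith
  have hq0 : ∀ j, 0 ≤ q j := fun j => integral_nonneg fun x => sq_nonneg _
  have hbound0 : ∀ ω, 0 ≤ bound ω := by
    intro ω
    obtain ⟨j, hj, -⟩ := hpoint ω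
    have := hq0 j
    exact le_trans (by positivity) hj
  have hesum_int : Integrable (fun ω => (∑ j, e j ω) / Fintype.card ι - 1) (designNoiseLaw σ n) :=
    ((integrable_finsetSum _ fun j _ => he_int j).div_const _).sub (integrable_const _)
  have hA := integrable_sum_comp_eval n hloss_int
  have hB := integrable_sum_comp_eval n hnoise_int
  have hC : Integrable (fun ω => (4 * σ ^ 2 + 4 * F ^ 2) *
      (Real.log (Fintype.card ι) + ((∑ j, e j ω) / Fintype.card ι - 1))) (designNoiseLaw σ n) :=
    ((integrable_const _).add hesum_int).const_mul _
  have hAB : Integrable (fun ω => ∑ i, loss f (ω i) + ∑ i, δ * (4 * F + 1 + (ω i).2 ^ 2))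
      (designNoiseLaw σ n) := hA.add hB
  have hABC : Integrable (fun ω => ∑ i, loss f (ω i) + ∑ i, δ * (4 * F + 1 + (ω i).2 ^ 2) +
      (4 * σ ^ 2 + 4 * F ^ 2) * (Real.log (Fintype.card ι) +
        ((∑ j, e j ω) / Fintype.card ι - 1))) (designNoiseLaw σ n) := hAB.add hC
  have hbound_int : Integrable bound (designNoiseLaw σ n) :=
    (integrable_const _).add (hABC.const_mul _)
  have hIe : ∫ ω, ((∑ j, e j ω) / Fintype.card ι - 1) ∂designNoiseLaw σ n ≤ 0 := by
    rw [integral_sub ((integrable_finsetSum _ fun j _ => he_int j).div_const _)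
      (integrable_const _), integral_div, integral_finsetSum _ fun j _ => he_int j]
    have h1 : ∑ j, ∫ ω, e j ω ∂designNoiseLaw σ n ≤ ∑ _j : ι, (1 : ℝ) :=
      Finset.sum_le_sum fun j _ => he_le j
    have h2 : (∑ j, ∫ ω, e j ω ∂designNoiseLaw σ n) / Fintype.card ι ≤ 1 := by
      rw [div_le_one hN]
      simpa using h1
    simpa using h2
  have hIA : ∫ ω, ∑ i, loss f (ω i) ∂designNoiseLaw σ n = n * ∫ x, (f x - f₀ x) ^ 2 := by
    rw [integral_sum_comp_eval n hloss_int]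
    exact congrArg _ (integral_excessLoss (hfm.sub hf₀) (hsubF _ (h𝓕 f hf)))
  have hIB : ∫ ω, ∑ i, δ * (4 * F + 1 + (ω i).2 ^ 2) ∂designNoiseLaw σ n =
      n * (δ * (4 * F + 1 + σ ^ 2)) := by
    rw [integral_sum_comp_eval n hnoise_int, integral_const_mul,
      integral_add (integrable_const _) ((integrable_sq_gaussianReal σ).comp_snd _),
      integral_fun_snd (fun y : ℝ => y ^ 2), integral_sq_gaussianReal]
    simp
  have hbound_le : ∫ ω, bound ω ∂designNoiseLaw σ n ≤ 2 * δ ^ 2 + 8 * (∫ x, (f x - f₀ x) ^ 2) +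
      8 * δ * (4 * F + 1 + σ ^ 2) +
        8 * (4 * σ ^ 2 + 4 * F ^ 2) * Real.log (Fintype.card ι) / n := by
    have h1 : ∫ ω, bound ω ∂designNoiseLaw σ n = 2 * δ ^ 2 + 8 / n *
        (n * (∫ x, (f x - f₀ x) ^ 2) + n * (δ * (4 * F + 1 + σ ^ 2)) +
          (4 * σ ^ 2 + 4 * F ^ 2) * (Real.log (Fintype.card ι) +
            ∫ ω, ((∑ j, e j ω) / Fintype.card ι - 1) ∂designNoiseLaw σ n)) := by
      simp only [bound]
      rw [integral_add (integrable_const _) (hABC.const_mul _),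
        integral_const_mul (8 / (n : ℝ)), integral_add hAB hC, integral_add hA hB, hIA, hIB,
        integral_const_mul (4 * σ ^ 2 + 4 * F ^ 2), integral_add (integrable_const _) hesum_int]
      simp
    have h2 := mul_le_mul_of_nonneg_left hIe
      (by positivity : 0 ≤ 8 / (n : ℝ) * (4 * σ ^ 2 + 4 * F ^ 2))
    rw [h1]
    have h3 : 8 / (n : ℝ) * n = 8 := by field_simp
    have h4 : 8 * (4 * σ ^ 2 + 4 * F ^ 2) * Real.log (Fintype.card ι) / n =
      8 / n * ((4 * σ ^ 2 + 4 * F ^ 2) * Real.log (Fintype.card ι)) := by ring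
    rw [h4]
    linear_combination h2 + ((∫ x, (f x - f₀ x) ^ 2) + δ * (4 * F + 1 + σ ^ 2)) * h3
  calc risk σ est f₀ ≤ ∫⁻ ω, ENNReal.ofReal (bound ω) ∂designNoiseLaw σ n := by
        refine lintegral_mono fun ω => ?_
        obtain ⟨j, hj, hjx⟩ := hpoint ω
        exact (lintegral_sq_sub_le (hNm j) hf₀ (hsubF _ (hNF j)) hjx).trans
          (ENNReal.ofReal_le_ofReal hj)
    _ = ENNReal.ofReal (∫ ω, bound ω ∂designNoiseLaw σ n) :=
        (ofReal_integral_eq_lintegral_ofReal hbound_int (ae_of_all _ hbound0)).symm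
    _ ≤ _ := ENNReal.ofReal_le_ofReal hbound_le

/-! ### A finite uniform net from a parameter grid -/

/-- The `j`-th of the `K + 1` equidistant points of `[-B, B]`. -/
noncomputable def gridPoint (B : ℝ) (K : ℕ) (j : Fin (K + 1)) : ℝ := -B + 2 * B * ((j : ℕ) / (K : ℝ))

theorem abs_gridPoint_le {B : ℝ} (hB : 0 ≤ B) {K : ℕ} (hK : 0 < K) (j : Fin (K + 1)) :
    |gridPoint B K j| ≤ B := by
  have hK' : (0 : ℝ) < K := by exact_mod_cast hK
  have hj : ((j : ℕ) : ℝ) ≤ K := by exact_mod_cast Nat.lt_succ_iff.1 j.2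
  have h0 : 0 ≤ ((j : ℕ) : ℝ) / K := by positivity
  have h1 : ((j : ℕ) : ℝ) / K ≤ 1 := (div_le_one hK').2 hj
  unfold gridPoint
  rw [abs_le]
  constructor <;> nlinarith

theorem exists_abs_sub_gridPoint_le {B : ℝ} (hB : 0 < B) {K : ℕ} (hK : 0 < K) {y : ℝ}
    (hy : |y| ≤ B) : ∃ j, |y - gridPoint B K j| ≤ 2 * B / K := by
  have hK' : (0 : ℝ) < K := by exact_mod_cast hK
  rw [abs_le] at hy
  obtain ⟨u, hu⟩ : ∃ u : ℝ, u = (y + B) * K / (2 * B) := ⟨_, rfl⟩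
  have hu0 : 0 ≤ u := by
    rw [hu]
    have : 0 ≤ y + B := by linarith
    positivity
  have huK : u ≤ K := by
    rw [hu, div_le_iff₀ (by positivity)]
    nlinarith
  have hyu : y = -B + 2 * B * (u / K) := by
    rw [hu]
    field_simp
    ring
  have hfl := Nat.floor_le hu0
  have hfl' := Nat.lt_floor_add_one u
  have hlt : ⌊u⌋₊ < K + 1 := by
    have : (⌊u⌋₊ : ℝ) ≤ K := hfl.trans huK
    exact Nat.lt_succ_iff.2 (by exact_mod_cast this)
  refine ⟨⟨⌊u⌋₊, hlt⟩, ?_⟩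
  have h1 : y - gridPoint B K ⟨⌊u⌋₊, hlt⟩ = 2 * B / K * (u - ⌊u⌋₊) := by
    rw [gridPoint, hyu]
    simp only
    ring
  rw [h1, abs_mul, abs_of_nonneg (by positivity : 0 ≤ 2 * B / K)]
  refine mul_le_of_le_one_right (by positivity) ?_
  rw [abs_le]
  constructor <;> linarith

/-- On $[0,1]$ the activation of a unit is at most $2B$ and moves by at most $2\eta$. Splitting
$or-o'r'=o(r-r')+(o-o')r'$ then gives $4B\eta$ per unit. -/
theorem abs_shallowNet_sub_le {D : ℕ} {B η : ℝ} {θ θ' : Fin 3 × Fin D → ℝ}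
    (hθ : ∀ p, |θ p| ≤ B) (hθ' : ∀ p, |θ' p| ≤ B) (hη : ∀ p, |θ p - θ' p| ≤ η)
    (x : unitInterval) :
    |shallowNet θ x - shallowNet θ' x| ≤ D * (4 * B * η) := by
  have hx0 := x.2.1
  have hx1 := x.2.2
  have hterm : ∀ d : Fin D, |θ (2, d) * max (θ (0, d) * x - θ (1, d)) 0 -
      θ' (2, d) * max (θ' (0, d) * x - θ' (1, d)) 0| ≤ 4 * B * η := by
    intro d
    have hB : 0 ≤ B := (abs_nonneg _).trans (hθ (0, d))
    have hη0 : 0 ≤ η := (abs_nonneg _).trans (hη (0, d))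
    have hmul : ∀ {y c : ℝ}, |y| ≤ c → |y * x| ≤ c := fun {y c} hy => by
      rw [abs_mul, abs_of_nonneg hx0]
      exact (mul_le_of_le_one_right (abs_nonneg _) hx1).trans hy
    have h1 : |max (θ (0, d) * x - θ (1, d)) 0 - max (θ' (0, d) * x - θ' (1, d)) 0| ≤ 2 * η := by
      refine (abs_max_sub_max_le_abs _ _ _).trans ?_
      have e : θ (0, d) * x - θ (1, d) - (θ' (0, d) * x - θ' (1, d)) =
        (θ (0, d) - θ' (0, d)) * x - (θ (1, d) - θ' (1, d)) := by ring
      rw [e]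
      refine (abs_sub _ _).trans ?_
      have := hmul (hη (0, d))
      linarith [hη (1, d)]
    have h2 : |max (θ' (0, d) * x - θ' (1, d)) 0| ≤ 2 * B := by
      have e := abs_max_sub_max_le_abs (θ' (0, d) * x - θ' (1, d)) 0 0
      rw [max_self, sub_zero, sub_zero] at e
      refine e.trans ((abs_sub _ _).trans ?_)
      have := hmul (hθ' (0, d))
      linarith [hθ' (1, d)]
    have e : ∀ o o' r r' : ℝ, o * r - o' * r' = o * (r - r') + (o - o') * r' := by
      intros
      ring
    rw [e]
    refine (abs_add_le _ _).trans ?_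
    rw [abs_mul, abs_mul]
    have h3 := mul_le_mul (hθ (2, d)) h1 (abs_nonneg _) hB
    have h4 := mul_le_mul (hη (2, d)) h2 (abs_nonneg _) hη0
    linarith
  unfold shallowNet
  rw [← Finset.sum_sub_distrib]
  refine (Finset.abs_sum_le_sum_abs _ _).trans ((Finset.sum_le_sum fun d _ => hterm d).trans ?_)
  simp

/-- The clipped network with the parameters of index `i` in the grid of mesh `2 * B / K`. -/
noncomputable def gridNet (F B : ℝ) (D K : ℕ) (i : Fin 3 × Fin D → Fin (K + 1)) (x : unitInterval) :
    ℝ :=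
  clip F (shallowNet (fun p => gridPoint B K (i p)) x)

theorem exists_gridNet_near {F B : ℝ} (hF : 0 < F) (hB : 0 < B) {D K : ℕ} (hK : 0 < K)
    {g : unitInterval → ℝ} (hg : g ∈ clippedNetworks F 1 (3 * D) D B) :
    ∃ i, ∀ x, |g x - gridNet F B D K i x| ≤ D * (4 * B * (2 * B / K)) := by
  obtain ⟨θ, hθ, hgθ⟩ := mem_clippedNetworks_one_iff.1 hg
  rw [mem_paramCube] at hθ
  choose i hi using fun p => exists_abs_sub_gridPoint_le hB hK (hθ p)
  refine ⟨i, fun x => ?_⟩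
  rw [hgθ]
  exact (abs_clip_sub_clip_le hF _ _).trans
    (abs_shallowNet_sub_le hθ (fun p => abs_gridPoint_le hB.le hK _) hi x)

theorem continuous_clip_shallowNet {F : ℝ} (hF : 0 < F) {D : ℕ} (θ : Fin 3 × Fin D → ℝ) :
    Continuous fun x : unitInterval => clip F (shallowNet θ x) := by
  refine (continuous_clip hF).comp ?_
  unfold shallowNet
  fun_prop

/-! ### Approximation of piecewise constant functions by ramps -/

theorem measurable_of_mem_jumpClass {k : ℕ} {C : ℝ} {f : unitInterval → ℝ}
    (hf : f ∈ jumpClass k C) : Measurable f := by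
  obtain ⟨a₀, a, t, -, -, -, h⟩ := hf
  rw [funext h]
  refine measurable_const.add (Finset.measurable_sum _ fun i _ => Measurable.const_mul ?_ _)
  exact (measurable_const.indicator measurableSet_Icc).comp measurable_subtype_coe

theorem abs_add_sum_mul_le {ι : Type*} [Fintype ι] {C a₀ : ℝ} {a r : ι → ℝ} (h₀ : |a₀| ≤ C)
    (ha : ∑ i, |a i| ≤ C) (hr : ∀ i, |r i| ≤ 1) : |a₀ + ∑ i, a i * r i| ≤ 2 * C := by
  have h1 : |∑ i, a i * r i| ≤ ∑ i, |a i| :=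
    (Finset.abs_sum_le_sum_abs _ _).trans <| Finset.sum_le_sum fun i _ => by
      rw [abs_mul]
      exact mul_le_of_le_one_right (abs_nonneg _) (hr i)
  have := abs_add_le a₀ (∑ i, a i * r i)
  linarith

theorem abs_le_of_mem_jumpClass {k : ℕ} {C : ℝ} {f : unitInterval → ℝ}
    (hf : f ∈ jumpClass k C) (x : unitInterval) : |f x| ≤ 2 * C := by
  obtain ⟨a₀, a, t, -, h₀, ha, h⟩ := hf
  rw [h]
  refine abs_add_sum_mul_le h₀ ha fun i => ?_
  by_cases hx : (x : ℝ) ∈ Set.Icc (t i) 1 <;> simp [hx]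

/-- The piecewise linear function that rises from `0` at `t - 1 / n` to `1` at `t`. -/
noncomputable def ramp (n : ℕ) (t x : ℝ) : ℝ := n * (max (x - (t - 1 / n)) 0 - max (x - t) 0)

theorem ramp_mem_Icc {n : ℕ} (hn : 0 < n) (t x : ℝ) : ramp n t x ∈ Set.Icc (0 : ℝ) 1 := by
  have hn' : (0 : ℝ) < n := by exact_mod_cast hn
  have h1 : (0 : ℝ) < 1 / n := by positivity
  have h2 : (n : ℝ) * (1 / n) = 1 := by field_simp
  have h3 : 0 ≤ max (x - (t - 1 / n)) 0 - max (x - t) 0 :=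
    sub_nonneg.2 (max_le_max (by linarith) le_rfl)
  have h4 : max (x - (t - 1 / n)) 0 - max (x - t) 0 ≤ 1 / n := by
    rw [sub_le_iff_le_add]
    refine max_le ?_ (by positivity)
    linarith [le_max_left (x - t) 0]
  exact ⟨mul_nonneg hn'.le h3, (mul_le_mul_of_nonneg_left h4 hn'.le).trans_eq h2⟩

theorem abs_ramp_sub_indicator_le {n : ℕ} (hn : 0 < n) (t : ℝ) (x : unitInterval) :
    |ramp n t x - (Set.Icc t 1).indicator (fun _ => (1 : ℝ)) (x : ℝ)| ≤
      (Set.Ioo (t - 1 / n) t).indicator (fun _ => (1 : ℝ)) (x : ℝ) := by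
  have hn' : (0 : ℝ) < n := by exact_mod_cast hn
  have h1 : (0 : ℝ) < 1 / n := by positivity
  have h2 : (n : ℝ) * (1 / n) = 1 := by field_simp
  rcases le_or_gt t x with h | h
  · have e : ramp n t x = 1 := by
      rw [ramp, max_eq_left (by linarith), max_eq_left (by linarith)]
      linear_combination h2
    rw [e, Set.indicator_of_mem (show (x : ℝ) ∈ Set.Icc t 1 from ⟨h, x.2.2⟩),
      Set.indicator_of_notMem fun hx => (not_lt.2 h) hx.2]
    simp
  · rw [Set.indicator_of_notMem (fun hx : (x : ℝ) ∈ Set.Icc t 1 => (not_le.2 h) hx.1), sub_zero]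
    rcases le_or_gt (x : ℝ) (t - 1 / n) with h' | h'
    · have e : ramp n t x = 0 := by
        rw [ramp, max_eq_right (by linarith), max_eq_right (by linarith)]
        ring
      rw [e, abs_zero]
      exact Set.indicator_nonneg (fun _ _ => zero_le_one) _
    · rw [Set.indicator_of_mem (show (x : ℝ) ∈ Set.Ioo (t - 1 / n) t from ⟨h', h⟩)]
      obtain ⟨h3, h4⟩ := ramp_mem_Icc hn t x
      rwa [abs_of_nonneg h3]

theorem integral_indicator_Ioo_le {s t : ℝ} (hst : s ≤ t) :
    ∫ x : unitInterval, (Set.Ioo s t).indicator (fun _ => (1 : ℝ)) (x : ℝ) ≤ t - s := by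
  have h1 : ∫ x : unitInterval, (Set.Ioo s t).indicator (fun _ => (1 : ℝ)) (x : ℝ) =
      ∫ x in Set.Icc (0 : ℝ) 1, (Set.Ioo s t).indicator (fun _ => (1 : ℝ)) x :=
    integral_subtype measurableSet_Icc ((Set.Ioo s t).indicator fun _ => (1 : ℝ))
  rw [h1, integral_indicator measurableSet_Ioo, Measure.restrict_restrict measurableSet_Ioo]
  simp only [integral_const, smul_eq_mul, mul_one, measureReal_restrict_apply_univ]
  calc volume.real (Set.Ioo s t ∩ Set.Icc 0 1) ≤ volume.real (Set.Ioo s t) :=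
        measureReal_mono Set.inter_subset_left measure_Ioo_lt_top.ne
    _ = t - s := by rw [Real.volume_real_Ioo_of_le hst]

theorem exists_mem_clippedNetworks_integral_sq_sub_le {k n : ℕ} (hn : 0 < n) {C B : ℝ} (hC : 0 < C)
    (hB : 1 ≤ B) (hCB : C * n ≤ B) {f₀ : unitInterval → ℝ} (hf₀ : f₀ ∈ jumpClass k C) :
    ∃ f ∈ clippedNetworks (2 * C) 1 (3 * (2 * k + 1)) (2 * k + 1) B,
      ∫ x, (f x - f₀ x) ^ 2 ≤ C ^ 2 / n := by
  obtain ⟨a₀, a, t, ht, h₀, ha, hf₀⟩ := hf₀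
  have hn' : (1 : ℝ) ≤ n := by exact_mod_cast hn
  have hinv : (0 : ℝ) < 1 / n ∧ (1 : ℝ) / n ≤ 1 := ⟨by positivity, (div_le_one (by linarith)).2 hn'⟩
  have ha' : ∀ i, |a i| ≤ C := fun i =>
    (Finset.single_le_sum (fun j _ => abs_nonneg (a j)) (Finset.mem_univ i)).trans ha
  have hna : ∀ i, |n * a i| ≤ B := fun i => by
    rw [abs_mul, Nat.abs_cast, mul_comm]
    exact (mul_le_mul_of_nonneg_right (ha' i) (by linarith)).trans hCB
  let e : Fin (2 * k + 1) ≃ Option (Fin k ⊕ Fin k) :=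
    (Fintype.equivFinOfCardEq (by simp; omega)).symm
  -- Each entry lists input weight, shift and output weight. The unit `none` has zero input weight
  -- and shift `-1`, so its activation is constantly one and it contributes `a₀`. Each jump uses two
  -- units, the two kinks of its ramp.
  let w : Option (Fin k ⊕ Fin k) → Fin 3 → ℝ := fun o => match o with
    | none => ![0, -1, a₀]
    | some (Sum.inl i) => ![1, t i - 1 / n, n * a i]
    | some (Sum.inr i) => ![1, t i, -(n * a i)]
  have hw : ∀ o c, |w o c| ≤ B := by
    rintro (_ | i | i) c <;> fin_cases c
    · simp [w]; linarith
    · simpa [w] using hB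
    · simp only [w]
      refine le_trans (le_trans h₀ ?_) hCB
      nlinarith
    · simpa [w] using hB
    · refine le_trans (abs_le.2 ?_) hB
      have := ht i
      change -1 ≤ t i - 1 / n ∧ t i - 1 / n ≤ 1
      constructor <;> linarith [this.1, this.2]
    · exact hna i
    · simpa [w] using hB
    · refine le_trans (abs_le.2 ?_) hB
      have := ht i
      change -1 ≤ t i ∧ t i ≤ 1
      constructor <;> linarith [this.1, this.2]
    · change |-(n * a i)| ≤ B
      rw [abs_neg]
      exact hna i
  have hnet : ∀ x, shallowNet (fun p => w (e p.2) p.1) x = a₀ + ∑ i, a i * ramp n (t i) x := by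
    intro x
    unfold shallowNet
    rw [e.sum_comp fun o => w o 2 * max (w o 0 * x - w o 1) 0, Fintype.sum_option,
      Fintype.sum_sum_type, ← Finset.sum_add_distrib]
    congr 1
    · simp [w]
    · refine Finset.sum_congr rfl fun i _ => ?_
      simp [w, ramp]
      ring
  have hle : ∀ x, |shallowNet (fun p => w (e p.2) p.1) x| ≤ 2 * C := by
    intro x
    rw [hnet]
    refine abs_add_sum_mul_le h₀ ha fun i => ?_
    obtain ⟨h1, h2⟩ := ramp_mem_Icc hn (t i) x
    rwa [abs_of_nonneg h1]
  refine ⟨fun x => a₀ + ∑ i, a i * ramp n (t i) x, mem_clippedNetworks_one_iff.2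
    ⟨fun p => w (e p.2) p.1, mem_paramCube.2 fun p => hw _ _, fun x => ?_⟩, ?_⟩
  · rw [clip_of_abs_le (by positivity) (hle x), hnet]
  let b : Fin k → unitInterval → ℝ := fun i x =>
    (Set.Ioo (t i - 1 / n) (t i)).indicator (fun _ => (1 : ℝ)) (x : ℝ)
  have hb0 : ∀ i x, 0 ≤ b i x := fun i x => Set.indicator_nonneg (fun _ _ => zero_le_one) _
  have hb1 : ∀ i x, b i x ≤ 1 := fun i x => Set.indicator_le_self' (fun _ _ => zero_le_one) _
  have hbm : ∀ i, Integrable (b i) := fun i =>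
    integrable_of_abs_le ((measurable_const.indicator measurableSet_Ioo).comp
      measurable_subtype_coe) (M := 1) fun x => by rw [abs_of_nonneg (hb0 i x)]; exact hb1 i x
  -- In the square of the error one factor is bounded by `C` and the other is kept. It is supported
  -- on intervals of length `1 / n`, which gives an integral of order `1 / n`.
  have hpt : ∀ x : unitInterval, (a₀ + ∑ i, a i * ramp n (t i) x - f₀ x) ^ 2 ≤
      C * ∑ i, |a i| * b i x := by
    intro x
    have h1 : |a₀ + ∑ i, a i * ramp n (t i) x - f₀ x| ≤ ∑ i, |a i| * b i x := by
      rw [hf₀, add_sub_add_left_eq_sub, ← Finset.sum_sub_distrib]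
      refine (Finset.abs_sum_le_sum_abs _ _).trans (Finset.sum_le_sum fun i _ => ?_)
      rw [← mul_sub, abs_mul]
      exact mul_le_mul_of_nonneg_left (abs_ramp_sub_indicator_le hn _ x) (abs_nonneg _)
    have h2 : ∑ i, |a i| * b i x ≤ C := (Finset.sum_le_sum fun i _ =>
      mul_le_of_le_one_right (abs_nonneg _) (hb1 i x)).trans ha
    rw [← sq_abs, sq]
    exact mul_le_mul (h1.trans h2) h1 (abs_nonneg _) hC.le
  have hsum_int : Integrable fun x : unitInterval => C * ∑ i, |a i| * b i x :=
    (integrable_finsetSum _ fun i _ => (hbm i).const_mul _).const_mul _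
  refine (integral_mono_of_nonneg (ae_of_all _ fun x => sq_nonneg _) hsum_int
    (ae_of_all _ hpt)).trans ?_
  rw [integral_const_mul, integral_finsetSum _ fun i _ => (hbm i).const_mul _]
  simp_rw [integral_const_mul]
  have h1 : ∑ i, |a i| * ∫ x, b i x ≤ ∑ i, |a i| * (1 / n) :=
    Finset.sum_le_sum fun i _ => mul_le_mul_of_nonneg_left
      ((integral_indicator_Ioo_le (by linarith)).trans_eq (by ring)) (abs_nonneg _)
  rw [← Finset.sum_mul] at h1
  have h2 := mul_le_mul_of_nonneg_right ha hinv.1.le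
  calc C * ∑ i, |a i| * ∫ x, b i x ≤ C * (C * (1 / n)) :=
        mul_le_mul_of_nonneg_left (h1.trans h2) hC.le
    _ = C ^ 2 / n := by ring

/-! ### The rate of convergence -/

theorem risk_le_of_isERM_clippedNetworks {k b n : ℕ} (hb : 0 < b) (hn : 0 < n) {C σ : ℝ}
    (hC : 0 < C) (hCb : C ≤ b) (hσ : 0 < σ) {f₀ : unitInterval → ℝ} (hf₀ : f₀ ∈ jumpClass k C)
    {est : Data n → unitInterval → ℝ}
    (hest : IsERM (clippedNetworks (2 * C) 1 (3 * (2 * k + 1)) (2 * k + 1) ((b * n : ℕ) : ℝ)) est) :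
    risk σ est f₀ ≤ ENNReal.ofReal ((2 + 8 * C ^ 2 + 8 * (4 * (2 * C) + 1 + σ ^ 2) +
      8 * (4 * σ ^ 2 + 4 * (2 * C) ^ 2) * (3 * (2 * k + 1)) *
        (Real.log (16 * (2 * k + 1) * b ^ 2) + 3 * Real.log n)) / n) := by
  have hn' : (1 : ℝ) ≤ n := by exact_mod_cast hn
  have hb' : (1 : ℝ) ≤ b := by exact_mod_cast hb
  have hF : 0 < 2 * C := by positivity
  have hB : (1 : ℝ) ≤ (b * n : ℕ) := by exact_mod_cast Nat.mul_pos hb hn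
  obtain ⟨f, hf, hfint⟩ := exists_mem_clippedNetworks_integral_sq_sub_le hn hC hB
    (by push_cast; exact mul_le_mul_of_nonneg_right hCb (by linarith)) hf₀
  -- Chosen so that the net radius $D\cdot4B\cdot2B/K$, with $D=2k+1$ and $B=bn$, is exactly $1/n$.
  obtain ⟨K, hKdef⟩ : ∃ K : ℕ, K = 8 * (2 * k + 1) * b ^ 2 * n ^ 3 := ⟨_, rfl⟩
  have hK : 0 < K := by rw [hKdef]; positivity
  have hKR : (K : ℝ) = 8 * (2 * k + 1) * b ^ 2 * n ^ 3 := by rw [hKdef]; push_cast; ring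
  have hδ : (((2 * k + 1 : ℕ) : ℝ) * (4 * ((b * n : ℕ) : ℝ) * (2 * ((b * n : ℕ) : ℝ) / K))) =
      1 / n := by
    rw [hKR]
    push_cast
    field_simp
    ring
  have hfm : Measurable f := by
    obtain ⟨θ, -, hθ⟩ := mem_clippedNetworks_one_iff.1 hf
    rw [funext hθ]
    exact (continuous_clip_shallowNet hF θ).measurable
  have hrisk := risk_le_of_isERM (δ := 1 / n) hσ hF hn
    (gridNet (2 * C) ((b * n : ℕ) : ℝ) (2 * k + 1) K)
    (fun i => (continuous_clip_shallowNet hF _).measurable) (fun i x => abs_clip_le hF _)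
    (fun g hg x => by
      obtain ⟨θ, -, hθ⟩ := mem_clippedNetworks_one_iff.1 hg
      rw [hθ]
      exact abs_clip_le hF _)
    (fun g hg => by
      rw [← hδ]
      exact exists_gridNet_near hF (by linarith) hK hg)
    (measurable_of_mem_jumpClass hf₀) (abs_le_of_mem_jumpClass hf₀) hf hfm hest
  refine hrisk.trans (ENNReal.ofReal_le_ofReal ?_)
  have hcard : Real.log (Fintype.card (Fin 3 × Fin (2 * k + 1) → Fin (K + 1))) ≤
      3 * (2 * k + 1) * (Real.log (16 * (2 * k + 1) * b ^ 2) + 3 * Real.log n) := by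
    have h1 : ((Fintype.card (Fin 3 × Fin (2 * k + 1) → Fin (K + 1)) : ℕ) : ℝ) =
        ((K : ℝ) + 1) ^ (3 * (2 * k + 1)) := by simp
    have h2 : ((3 * (2 * k + 1) : ℕ) : ℝ) = 3 * (2 * k + 1) := by push_cast; ring
    rw [h1, Real.log_pow, h2]
    refine mul_le_mul_of_nonneg_left ?_ (by positivity)
    have h3 : (3 : ℝ) * Real.log n = Real.log ((n : ℝ) ^ 3) := by
      rw [Real.log_pow]
      norm_num
    rw [h3, ← Real.log_mul (by positivity) (by positivity)]
    refine Real.log_le_log (by positivity) ?_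
    -- The constant 16 comes from $K+1\le2K$.
    have h4 : (1 : ℝ) ≤ K := by exact_mod_cast hK
    linarith
  have h1 : 2 * (1 / (n : ℝ)) ^ 2 ≤ 2 / n := by
    rw [div_pow, one_pow, mul_one_div]
    exact div_le_div_of_nonneg_left (by norm_num) (by linarith) (by nlinarith)
  have h2 : 8 * (4 * σ ^ 2 + 4 * (2 * C) ^ 2) *
      Real.log (Fintype.card (Fin 3 × Fin (2 * k + 1) → Fin (K + 1))) / n ≤
      8 * (4 * σ ^ 2 + 4 * (2 * C) ^ 2) * (3 * (2 * k + 1) *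
        (Real.log (16 * (2 * k + 1) * b ^ 2) + 3 * Real.log n)) / n := by
    gcongr
  refine (add_le_add (add_le_add (add_le_add h1 (mul_le_mul_of_nonneg_left hfint
    (by norm_num : (0 : ℝ) ≤ 8))) le_rfl) h2).trans_eq ?_
  ring

/-- Weakens a bound affine in $\log n$ to a multiple of $(\log n)^3$, using that $\log n$ stays
above $\log 2$. -/
theorem add_mul_le_mul_cube {u v l₀ l : ℝ} (hu : 0 ≤ u) (hv : 0 ≤ v) (hl₀ : 0 < l₀) (hl : l₀ ≤ l) :
    u + v * l ≤ (u / l₀ ^ 3 + v / l₀ ^ 2) * l ^ 3 := by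
  have hl' : 0 < l := hl₀.trans_le hl
  have h1 : 1 ≤ l ^ 3 / l₀ ^ 3 := (one_le_div (by positivity)).2 (pow_le_pow_left₀ hl₀.le hl 3)
  have h2 : 1 ≤ l ^ 2 / l₀ ^ 2 := (one_le_div (by positivity)).2 (pow_le_pow_left₀ hl₀.le hl 2)
  calc u + v * l ≤ u * (l ^ 3 / l₀ ^ 3) + v * l * (l ^ 2 / l₀ ^ 2) :=
        add_le_add (le_mul_of_one_le_right hu h1) (le_mul_of_one_le_right (by positivity) h2)
    _ = _ := by ring

end ReLURegression

theorem corollary2 (k : ℕ) (hk : 1 ≤ k) (C : ℝ) (hC : 0 < C) :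
    ∃ (F : ℝ) (L S D : ℕ → ℕ) (B : ℕ → ℝ),
      0 < F ∧
      (∀ n : ℕ, 2 ≤ n → 1 ≤ L n ∧ 1 ≤ S n ∧ 1 ≤ D n ∧ 1 ≤ B n) ∧
      (∃ C₁ : ℝ, 0 < C₁ ∧ ∀ n : ℕ, 2 ≤ n →
        (L n : ℝ) ≤ C₁ * Real.log n ∧ (S n : ℝ) ≤ C₁ * Real.log n ∧
        (D n : ℝ) ≤ C₁ * Real.log n ∧ B n ≤ C₁ * n) ∧
      (∀ n : ℕ, 2 ≤ n → ∃ est : ReLURegression.Data n → unitInterval → ℝ,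
        ReLURegression.IsERM
          (ReLURegression.clippedNetworks F (L n) (S n) (D n) (B n)) est) ∧
      ∀ σ : ℝ, 0 < σ → ∃ C₃ : ℝ, 0 < C₃ ∧
        ∀ n : ℕ, 2 ≤ n → ∀ est : ReLURegression.Data n → unitInterval → ℝ,
          ReLURegression.IsERM
            (ReLURegression.clippedNetworks F (L n) (S n) (D n) (B n)) est →
          (⨆ f₀ ∈ ReLURegression.jumpClass k C, ReLURegression.risk σ est f₀)
            ≤ ENNReal.ofReal (C₃ * (Real.log n ^ 3 / n)) := by
  obtain ⟨b, hCb⟩ := exists_nat_ge (max C 1)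
  have hb : 0 < b := by
    have : (1 : ℝ) ≤ b := (le_max_right _ _).trans hCb
    exact_mod_cast lt_of_lt_of_le zero_lt_one this
  have hCb' : C ≤ b := (le_max_left _ _).trans hCb
  have hb' : (1 : ℝ) ≤ b := by exact_mod_cast hb
  have hlog2 : 0 < Real.log 2 := Real.log_pos one_lt_two
  have hlog : ∀ n : ℕ, 2 ≤ n → Real.log 2 ≤ Real.log n := fun n hn =>
    Real.log_le_log two_pos (by exact_mod_cast hn)
  have hB : ∀ n : ℕ, 2 ≤ n → (1 : ℝ) ≤ ((b * n : ℕ) : ℝ) := fun n hn => by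
    exact_mod_cast Nat.mul_pos hb (by omega : 0 < n)
  -- Depth, sparsity and width are constant in `n`, and only the weight bound grows. Clipping at `2
  -- * C` is harmless because it bounds both the jump functions and their ramp approximations.
  refine ⟨2 * C, fun _ => 1, fun _ => 3 * (2 * k + 1), fun _ => 2 * k + 1,
    fun n => ((b * n : ℕ) : ℝ), by positivity, ?_, ?_, ?_, ?_⟩
  · exact fun n hn => ⟨le_rfl, Nat.mul_pos three_pos (Nat.succ_pos _), Nat.succ_pos _, hB n hn⟩
  · refine ⟨3 * (2 * k + 1) / Real.log 2 + b, by positivity, fun n hn => ?_⟩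
    have h1 : (3 * (2 * k + 1) : ℝ) ≤ (3 * (2 * k + 1) / Real.log 2 + b) * Real.log n := by
      have h2 : (3 * (2 * k + 1) : ℝ) / Real.log 2 * Real.log 2 = 3 * (2 * k + 1) :=
        div_mul_cancel₀ _ hlog2.ne'
      have h3 : (0 : ℝ) ≤ b * Real.log n := mul_nonneg (by linarith) (hlog2.le.trans (hlog n hn))
      have h4 := mul_le_mul_of_nonneg_left (hlog n hn)
        (by positivity : (0 : ℝ) ≤ 3 * (2 * k + 1) / Real.log 2)
      linarith
    have hk0 : (0 : ℝ) ≤ k := Nat.cast_nonneg k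
    refine ⟨?_, ?_, ?_, ?_⟩
    · push_cast
      linarith
    · push_cast
      linarith
    · push_cast
      linarith
    · push_cast
      exact mul_le_mul_of_nonneg_right (le_add_of_nonneg_left (by positivity)) (Nat.cast_nonneg n)
  · exact fun n hn => ReLURegression.exists_isERM_clippedNetworks (by positivity)
      (zero_le_one.trans (hB n hn)) _ n
  · intro σ hσ
    let v : ℝ := 8 * (4 * σ ^ 2 + 4 * (2 * C) ^ 2) * (3 * (2 * k + 1))
    let u : ℝ := 2 + 8 * C ^ 2 + 8 * (4 * (2 * C) + 1 + σ ^ 2) +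
      v * Real.log (16 * (2 * k + 1) * b ^ 2)
    have hv : 0 < v := by positivity
    have hu : 0 ≤ u := by
      have h1 : (1 : ℝ) ≤ 16 * (2 * k + 1) * b ^ 2 := by
        exact_mod_cast Nat.succ_le_of_lt (by positivity : 0 < 16 * (2 * k + 1) * b ^ 2)
      have := Real.log_nonneg h1
      positivity
    refine ⟨u / Real.log 2 ^ 3 + v * 3 / Real.log 2 ^ 2, by positivity, fun n hn est hest => ?_⟩
    refine iSup₂_le fun f₀ hf₀ => ?_
    refine (ReLURegression.risk_le_of_isERM_clippedNetworks hb (by omega) hC hCb' hσ hf₀ hest).trans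
      (ENNReal.ofReal_le_ofReal ?_)
    rw [← mul_div_assoc]
    refine div_le_div_of_nonneg_right (le_trans (le_of_eq ?_) (ReLURegression.add_mul_le_mul_cube hu
      (by positivity : 0 ≤ v * 3) hlog2 (hlog n hn))) (Nat.cast_nonneg n)
    simp only [u, v]
    ring
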